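/- Let $N_t, N_r \ge 1$ be integers and $\rho > 0$. Let $\mathbf{H}$ be a random $N_r \times N_t$ complex matrix whose entries are independent standard circularly symmetric complex Gaussians $\mathcal{CN}(0,1)$ (Rayleigh fading channel of an arbitrary user, with $N_t$ transmit antennas, $N_r$ receive antennas and average SNR $\rho$). For $i \in \{1,\dots,N_t\}$ let $\mathbf{h}_i$ be the $i$th column of $\mathbf{H}$, let $\mathbf{K}$ be $\mathbf{H}$ with its $i$th column removed, and let $$\gamma = \frac{\rho}{N_t}\,\mathbf{h}_i^\dagger\Big(\frac{\rho}{N_t}\mathbf{K}\mathbf{K}^\dagger + \mathbf{I}_{N_r}\Big)^{-1}\mathbf{h}_i, \qquad X = \frac{N_t\,\gamma}{\rho}$$ be the SINR and the normalized SINR of the $i$th stream with an MMSE receiver. Then $\log_2\big(1+\frac{\rho}{N_t}X\big)$ is integrable, and the round-robin maximum sum-rate $R^{\rm rr}_{\rm MMSE}(\rho) = N_t\,\mathrm{E}\big[\log_2\big(1 + \frac{\rho}{N_t} X\big)\big]$ is, for every $i$, $$R^{\rm rr}_{\rm MMSE}(\rho) = \log_2(e) \left(\frac{N_t}{\rho}\right)^{N_t-1}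 N_t\, e^{N_t/\rho} \sum_{k=0}^{N_r-1} \beta_k \left(\frac{N_t}{\rho}\right)^k \sum_{q=0}^k \binom{k}{q} (-1)^{k-q} \left(\frac{\rho}{N_t}\right)^{q} \Gamma\!\left(1-N_t+q,\frac{N_t}{\rho}\right),$$ where $$\beta_k = \left(\frac{\rho}{N_t}\right)^k \sum_{p=\max(0,k-N_t+1)}^k \frac{\binom{N_t-1}{k-p}}{p!\,(\rho/N_t)^p}, \qquad \Gamma(s,x) = \int_x^\infty t^{s-1}e^{-t}\,dt .$$ -/

import Mathlib

open MeasureTheory ProbabilityTheory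
open scoped Matrix NNReal

namespace MimoScheduling

/-- The circularly symmetric standard complex Gaussian law `CN(0, 1)`: the real and the imaginary
part are independent real Gaussians of mean `0` and variance `1/2`. -/
noncomputable def stdComplexGaussian : Measure ℂ :=
  ((gaussianReal 0 (1 / 2)).prod (gaussianReal 0 (1 / 2))).map Complex.measurableEquivRealProd.symm

/-- The Rayleigh fading law on `Nr × Nt` complex matrices (given by their entries): the entries are
independent and each of them is `CN(0, 1)`. -/
noncomputable def rayleighLaw (Nr Nt : ℕ) : Measure (Fin Nr → Fin Nt → ℂ) :=
  Measure.pi fun _ => Measure.pi fun _ => stdComplexGaussian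

/-- The matrix `K`: the channel matrix `H` with its column `k` removed. -/
def interferenceMatrix {Nr Nt : ℕ} (H : Matrix (Fin Nr) (Fin Nt) ℂ) (k : Fin Nt) :
    Matrix (Fin Nr) {j : Fin Nt // j ≠ k} ℂ :=
  H.submatrix id Subtype.val

/-- The SINR of stream `k` with an MMSE receiver,
`γ = (ρ / Nt) hₖ† ((ρ / Nt) K K† + I)⁻¹ hₖ`, with `hₖ` the `k`th column of `H`. -/
noncomputable def mmseSINR {Nr Nt : ℕ} (ρ : ℝ) (H : Matrix (Fin Nr) (Fin Nt) ℂ) (k : Fin Nt) : ℝ :=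
  ρ / Nt *
    (star (H.col k) ⬝ᵥ
      (((ρ / Nt : ℝ) : ℂ) • (interferenceMatrix H k * (interferenceMatrix H k)ᴴ) + 1)⁻¹ *ᵥ
        H.col k).re

/-- The normalized MMSE SINR `X = Nt γ / ρ`. -/
noncomputable def normalizedMmseSINR {Nr Nt : ℕ} (ρ : ℝ) (H : Matrix (Fin Nr) (Fin Nt) ℂ)
    (k : Fin Nt) : ℝ :=
  Nt * mmseSINR ρ H k / ρ

/-- The round-robin maximum sum-rate `Nt E[log₂ (1 + (ρ / Nt) X)]`. -/
noncomputable def roundRobinSumRate {Ω : Type*} [MeasurableSpace Ω] (P : Measure Ω) (Nt : ℕ)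
    (ρ : ℝ) (X : Ω → ℝ) : ℝ :=
  Nt * ∫ ω, Real.logb 2 (1 + ρ / Nt * X ω) ∂P

/-- The upper incomplete gamma function `Γ(s, x) = ∫ₓ^∞ t^(s-1) e^(-t) dt`, for `x > 0` and an
arbitrary real `s`. -/
noncomputable def upperIncompleteGamma (s x : ℝ) : ℝ :=
  ∫ t in Set.Ioi x, t ^ (s - 1) * Real.exp (-t)

/-- `βₖ = (ρ / Nt)^k ∑_{p = max(0, k - Nt + 1)}^k binom(Nt - 1, k - p) / (p! (ρ / Nt)^p)`, for
`Nt ≥ 1`; the truncated difference `k + 1 - Nt` is `max(0, k - Nt + 1)`. -/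
noncomputable def mmseBeta (Nt : ℕ) (ρ : ℝ) (k : ℕ) : ℝ :=
  (ρ / Nt) ^ k *
    ∑ p ∈ Finset.Icc (k + 1 - Nt) k,
      ((Nt - 1).choose (k - p) : ℝ) / ((p.factorial : ℝ) * (ρ / Nt) ^ p)

end MimoScheduling

/-! With c = ρ/Nt, X is the form h†(cKK† + I)⁻¹h with h and K independent and Gaussian. Everything
rests on its exact tail `mmseTail c n m` for n receive antennas and m interferers, proved in
`stdComplexGaussianVector_prod_lt_regularizedForm`.

The tail follows by induction on n + m. The law of K is unitarily invariant, so h may be rotated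
onto a coordinate axis, and X has the law of ‖h‖² times a diagonal entry of (cKK† + I)⁻¹. By a Schur
complement (`regularizedForm_single`) that entry is 1/(1 + cY), where Y is the same form built from
one row of K and the transpose of the other rows: m antennas and n - 1 interferers. Since ‖h‖² is a
sum of n unit exponentials independent of Y, P(X > x) = E[erlangTail n (x(1 + cY))]. When this is
written through the tail of Y (`lintegral_erlangTail`), the Erlang density brings a factor (1 +
cy)^(n-1) that cancels the denominator of that tail. Only gamma integrals are left, and the finite
identity `mmseTail_succ` resums them.

Finally E[log(1 + cX)] = ∫ P(X > t) c/(1 + ct) dt, and the shift u = t + 1/c followed by a binomial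
expansion produces the incomplete gamma functions. -/

open scoped ComplexOrder ENNReal

namespace MimoScheduling

/-! ### Regularized quadratic forms: unitary invariance and bordering. -/

section LinearAlgebra

variable {ι κ : Type*} [Fintype ι] [Fintype κ] [DecidableEq ι] [DecidableEq κ]

/-- The regularized quadratic form `h† (c K K† + I)⁻¹ h`. -/
noncomputable def regularizedForm (c : ℝ) (h : ι → ℂ) (K : Matrix ι κ ℂ) : ℝ :=
  (star h ⬝ᵥ ((c : ℂ) • (K * Kᴴ) + 1)⁻¹ *ᵥ h).re

omit [Fintype ι] [DecidableEq κ] in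
lemma posDef_smul_mul_conjTranspose_add_one [Finite ι] {c : ℝ} (hc : 0 ≤ c) (K : Matrix ι κ ℂ) :
    ((c : ℂ) • (K * Kᴴ) + 1).PosDef := by
  refine Matrix.PosDef.posSemidef_add ?_ Matrix.PosDef.one
  exact (Matrix.posSemidef_self_mul_conjTranspose K).smul (by exact_mod_cast hc)

omit [DecidableEq κ] in
-- A positive semidefinite matrix has a real quadratic form, so the real part in the definition
-- discards nothing.
lemma regularizedForm_coe {c : ℝ} (hc : 0 ≤ c) (h : ι → ℂ) (K : Matrix ι κ ℂ) :
    (regularizedForm c h K : ℂ) = star h ⬝ᵥ ((c : ℂ) • (K * Kᴴ) + 1)⁻¹ *ᵥ h := by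
  have := (posDef_smul_mul_conjTranspose_add_one hc K).inv.posSemidef.dotProduct_mulVec_nonneg h
  exact (Complex.eq_re_of_ofReal_le (r := 0) (by simpa using this)).symm

omit [DecidableEq κ] in
lemma regularizedForm_nonneg {c : ℝ} (hc : 0 ≤ c) (h : ι → ℂ) (K : Matrix ι κ ℂ) :
    0 ≤ regularizedForm c h K := by
  have := (posDef_smul_mul_conjTranspose_add_one hc K).inv.posSemidef.dotProduct_mulVec_nonneg h
  rw [← regularizedForm_coe hc] at this
  exact_mod_cast this

omit [DecidableEq κ] in
lemma regularizedForm_unitary (c : ℝ) (h : ι → ℂ) (K : Matrix ι κ ℂ) (U : Matrix ι ι ℂ)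
    (hU : Uᴴ * U = 1) :
    regularizedForm c (U *ᵥ h) (U * K) = regularizedForm c h K := by
  have hU' : U * Uᴴ = 1 := mul_eq_one_comm.mp hU
  have h1 : (c : ℂ) • (U * K * (U * K)ᴴ) + 1 = U * ((c : ℂ) • (K * Kᴴ) + 1) * Uᴴ := by
    simp [Matrix.conjTranspose_mul, Matrix.mul_add, Matrix.add_mul, hU', Matrix.mul_assoc]
  have h2 : (U * ((c : ℂ) • (K * Kᴴ) + 1) * Uᴴ)⁻¹ = U * ((c : ℂ) • (K * Kᴴ) + 1)⁻¹ * Uᴴ := by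
    rw [Matrix.mul_inv_rev, Matrix.mul_inv_rev, Matrix.inv_eq_left_inv hU,
      Matrix.inv_eq_left_inv hU', Matrix.mul_assoc]
  rw [regularizedForm, regularizedForm, h1, h2, Matrix.star_mulVec, ← Matrix.dotProduct_mulVec,
    Matrix.mulVec_mulVec, Matrix.mulVec_mulVec, ← Matrix.mul_assoc, ← Matrix.mul_assoc, hU,
    Matrix.one_mul, Matrix.mul_assoc, hU, Matrix.mul_one]

omit [DecidableEq κ] in
lemma regularizedForm_smul (c : ℝ) (a : ℝ) (h : ι → ℂ) (K : Matrix ι κ ℂ) :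
    regularizedForm c ((a : ℂ) • h) K = a ^ 2 * regularizedForm c h K := by
  have : star ((a : ℂ) • h) = (a : ℂ) • star h := by
    ext i; simp
  rw [regularizedForm, regularizedForm, this, Matrix.mulVec_smul, dotProduct_smul, smul_dotProduct]
  simp [pow_two, mul_assoc]

omit [DecidableEq κ] in
-- The inverse is the adjugate over the determinant, which positive definiteness keeps nonzero.
lemma continuous_regularizedForm {c : ℝ} (hc : 0 ≤ c) :
    Continuous fun p : (ι → ℂ) × Matrix ι κ ℂ => regularizedForm c p.1 p.2 := by
  have hA : Continuous fun p : (ι → ℂ) × Matrix ι κ ℂ => ((c : ℂ) • (p.2 * p.2ᴴ) + 1) := by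
    fun_prop
  have hinv : Continuous fun p : (ι → ℂ) × Matrix ι κ ℂ => ((c : ℂ) • (p.2 * p.2ᴴ) + 1)⁻¹ := by
    simp only [Matrix.inv_def, Ring.inverse_eq_inv']
    refine Continuous.smul (Continuous.inv₀ hA.matrix_det fun p => ?_) hA.matrix_adjugate
    exact ((posDef_smul_mul_conjTranspose_add_one hc p.2).isUnit.map Matrix.detMonoidHom).ne_zero
  unfold regularizedForm
  exact Complex.continuous_re.comp
    ((continuous_fst.star).dotProduct (hinv.matrix_mulVec continuous_fst))

/-- Bordering: the `(i, i)` entry of `(c K K† + I)⁻¹` through the Schur complement. -/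
lemma regularizedForm_single {c : ℝ} (hc : 0 ≤ c) (i : ι) (K : Matrix ι κ ℂ) :
    regularizedForm c (Pi.single i 1) K =
      (1 + c * regularizedForm c (K i)
        (Matrix.of fun (j : κ) (l : {l // l ≠ i}) => K l j))⁻¹ := by
  set L : Matrix κ {l // l ≠ i} ℂ := Matrix.of fun j l => K l j with hL
  set y := regularizedForm c (K i) L with hy
  set w' := ((c : ℂ) • (L * Lᴴ) + 1)⁻¹ *ᵥ K i with hw'
  have hy0 : 0 ≤ y := regularizedForm_nonneg hc _ _
  have hyw : K i ⬝ᵥ star w' = (y : ℂ) := by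
    have h1 : (y : ℂ) = star (K i) ⬝ᵥ w' := regularizedForm_coe hc _ _
    have h2 : (y : ℂ) = star (y : ℂ) := by simp
    rw [h2, h1, Matrix.star_dotProduct, star_star, dotProduct_comm]
  have hwK : ((c : ℂ) • (L * Lᴴ) + 1) *ᵥ w' = K i := by
    rw [hw', Matrix.mulVec_mulVec, Matrix.mul_nonsing_inv, Matrix.one_mulVec]
    exact (posDef_smul_mul_conjTranspose_add_one hc L).isUnit.map Matrix.detMonoidHom
  -- the explicit solution `v` of `(c K K† + I) v = (1 + c y) eᵢ`
  set v : ι → ℂ := fun l => if l = i then 1 else -(c : ℂ) * (K l ⬝ᵥ star w') with hv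
  -- The conjugate of `hwK`. It makes coordinate `l ≠ i` of `(c K K† + I) v` cancel and coordinate
  -- `i` equal `1 + c y`.
  have hKv : Kᴴ *ᵥ v = star w' := by
    have h3 : star w' = star (K i) - (c : ℂ) • star ((L * Lᴴ) *ᵥ w') := by
      rw [eq_sub_iff_add_eq]
      conv_rhs => rw [← hwK]
      rw [Matrix.add_mulVec, Matrix.one_mulVec, Matrix.smul_mulVec, star_add, add_comm]
      congr 1
      ext j; simp
    ext j
    have h4 : (Kᴴ *ᵥ v) j = star (K i j) + ∑ l : {l // l ≠ i}, star (K l j) * v l := by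
      simp only [Matrix.mulVec, dotProduct, Matrix.conjTranspose_apply]
      rw [← Finset.add_sum_erase _ _ (Finset.mem_univ i)]
      congr 1
      · simp [hv]
      · rw [← Finset.sum_subtype (Finset.univ.erase i) (p := fun l => l ≠ i)
          (f := fun l => star (K l j) * v l) (by simp)]
    rw [h4, h3]
    simp only [Pi.sub_apply, Pi.star_apply, Pi.smul_apply, smul_eq_mul, sub_eq_add_neg]
    congr 1
    rw [← Matrix.mulVec_mulVec, Matrix.mulVec, dotProduct, star_sum, Finset.mul_sum,
      ← Finset.sum_neg_distrib]
    refine Finset.sum_congr rfl fun l _ => ?_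
    have h5 : v l = -(c : ℂ) * (K l ⬝ᵥ star w') := by simp [hv, l.2]
    have h6 : K l ⬝ᵥ star w' = star ((Lᴴ *ᵥ w') l) := by
      simp only [Matrix.mulVec, dotProduct, hL, star_sum, Matrix.conjTranspose_apply,
        Matrix.of_apply, star_mul', star_star, Pi.star_apply]
    rw [h5, h6, star_mul', hL]
    simp only [Matrix.of_apply]
    ring
  have hAv : ((c : ℂ) • (K * Kᴴ) + 1) *ᵥ v = (1 + (c : ℂ) * y) • Pi.single i 1 := by
    rw [Matrix.add_mulVec, Matrix.one_mulVec, Matrix.smul_mulVec, ← Matrix.mulVec_mulVec, hKv]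
    ext l
    by_cases hl : l = i
    · subst hl
      have : (K *ᵥ star w') l = y := hyw
      simp [hv, this, add_comm]
    · simp [hv, hl, Matrix.mulVec]
  have hne : (1 + (c : ℂ) * y) ≠ 0 := by
    have : (1 + c * y : ℝ) ≠ 0 := by positivity
    exact_mod_cast this
  have hAe : ((c : ℂ) • (K * Kᴴ) + 1)⁻¹ *ᵥ Pi.single i 1 = (1 + (c : ℂ) * y)⁻¹ • v := by
    have h7 : ((c : ℂ) • (K * Kᴴ) + 1)⁻¹ *ᵥ (((c : ℂ) • (K * Kᴴ) + 1) *ᵥ v) = v := by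
      rw [Matrix.mulVec_mulVec, Matrix.nonsing_inv_mul, Matrix.one_mulVec]
      exact (posDef_smul_mul_conjTranspose_add_one hc K).isUnit.map Matrix.detMonoidHom
    rw [hAv, Matrix.mulVec_smul] at h7
    rw [← h7, smul_smul, inv_mul_cancel₀ hne, one_smul]
  have hfin : (regularizedForm c (Pi.single i 1) K : ℂ) = ((1 + c * y)⁻¹ : ℝ) := by
    rw [regularizedForm_coe hc, hAe]
    have : star (Pi.single i 1 : ι → ℂ) = Pi.single i 1 := by
      ext l; by_cases hl : l = i
      · subst hl; simp
      · simp [hl]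
    rw [this]
    simp [hv]
  exact_mod_cast hfin

omit [DecidableEq κ] in
/-- Every vector is rotated by a unitary matrix onto a coordinate axis. -/
lemma exists_unitary_mulVec_eq_single (h : ι → ℂ) (i : ι) :
    ∃ U : Matrix ι ι ℂ, Uᴴ * U = 1 ∧
      U *ᵥ h = ((√(∑ l, ‖h l‖ ^ 2) : ℝ) : ℂ) • Pi.single i 1 := by
  set r : ℝ := √(∑ l, ‖h l‖ ^ 2) with hr
  by_cases h0 : r = 0
  · refine ⟨1, by simp, ?_⟩
    rw [hr, Real.sqrt_eq_zero (by positivity),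
      Finset.sum_eq_zero_iff_of_nonneg (fun _ _ => by positivity)] at h0
    have : h = 0 := by
      ext l; simpa using h0 l (Finset.mem_univ l)
    simp [hr, this]
  have hrn : ‖WithLp.toLp 2 h‖ = r := by rw [EuclideanSpace.norm_eq]
  set u : EuclideanSpace ℂ ι := ((r : ℂ)⁻¹) • WithLp.toLp 2 h with hu
  have hun : ‖u‖ = 1 := by
    have hrpos : 0 ≤ r := Real.sqrt_nonneg _
    rw [hu, norm_smul, hrn, norm_inv, Complex.norm_real, Real.norm_eq_abs, abs_of_nonneg hrpos,
      inv_mul_cancel₀ h0]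
  -- The rows of `U` will be the conjugates of an orthonormal basis whose `i`th vector is h/‖h‖, so
  -- `U *ᵥ h` lists the inner products of h with that basis.
  have horth : Orthonormal ℂ (({i} : Set ι).domRestrict fun _ => u) := by
    refine ⟨fun _ => hun, fun a b hab => (hab (Subsingleton.elim a b)).elim⟩
  obtain ⟨b, hb⟩ := horth.exists_orthonormalBasis_extension_of_card_eq (by simp)
  have hbi : b i = u := hb i rfl
  refine ⟨Matrix.of fun j l => star (b j l), ?_, ?_⟩
  · refine mul_eq_one_comm.mp ?_
    ext j k
    have := orthonormal_iff_ite.mp b.orthonormal j k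
    rw [PiLp.inner_apply] at this
    simp only [Matrix.mul_apply, Matrix.conjTranspose_apply, Matrix.of_apply, star_star,
      Matrix.one_apply]
    rw [← this]
    exact Finset.sum_congr rfl fun l _ => by simp [mul_comm]
  · ext j
    have h1 : WithLp.toLp 2 h = (r : ℂ) • b i := by
      rw [hbi, hu, smul_smul, mul_inv_cancel₀ (by exact_mod_cast h0), one_smul]
    have h2 : inner ℂ (b j) (WithLp.toLp 2 h) = (r : ℂ) * if j = i then 1 else 0 := by
      rw [h1, inner_smul_right, orthonormal_iff_ite.mp b.orthonormal j i]
    rw [PiLp.inner_apply] at h2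
    simp only [Matrix.mulVec, dotProduct, Matrix.of_apply, Pi.smul_apply, smul_eq_mul,
      Pi.single_apply]
    rw [← h2]
    exact Finset.sum_congr rfl fun l _ => by simp [mul_comm]

end LinearAlgebra

/-! ### Complex Gaussian vectors: characteristic functions and invariance. -/

section GaussianVectors

instance : IsProbabilityMeasure stdComplexGaussian :=
  Measure.isProbabilityMeasure_map Complex.measurableEquivRealProd.symm.measurable.aemeasurable

/-- The law of a vector with independent `CN(0, 1)` entries. -/
noncomputable def stdComplexGaussianVector (α : Type*) [Fintype α] : Measure (α → ℂ) :=
  Measure.pi fun _ => stdComplexGaussian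

instance (α : Type*) [Fintype α] : IsProbabilityMeasure (stdComplexGaussianVector α) := by
  unfold stdComplexGaussianVector; infer_instance

lemma charFunDual_stdComplexGaussian (L : StrongDual ℝ ℂ) :
    charFunDual stdComplexGaussian L =
      Complex.exp (-((L 1 ^ 2 + L Complex.I ^ 2) / 4 : ℝ)) := by
  have h1 : stdComplexGaussian = ((gaussianReal 0 (1 / 2)).prod (gaussianReal 0 (1 / 2))).map
      (Complex.equivRealProdCLM.symm : ℝ × ℝ →L[ℝ] ℂ) := rfl
  have key : ∀ M : StrongDual ℝ ℝ, charFunDual (gaussianReal 0 (1 / 2)) M =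
      Complex.exp (-((M 1 ^ 2 / 4 : ℝ) : ℂ)) := by
    intro M
    have : M = (InnerProductSpace.toDual ℝ ℝ) (M 1) := by
      ext; simp
    rw [this, ← charFun_toDual_symm_eq_charFunDual, LinearIsometryEquiv.symm_apply_apply,
      charFun_gaussianReal]
    congr 1
    simp
    ring
  rw [h1, charFunDual_map, charFunDual_prod, key, key, ← Complex.exp_add]
  congr 1
  have e1 : Complex.equivRealProdCLM.symm (1, 0) = 1 := by
    apply Complex.ext <;> simp
  have e2 : Complex.equivRealProdCLM.symm (0, 1) = Complex.I := by
    apply Complex.ext <;> simp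
  simp [e1, e2]
  ring

variable {α : Type*} [Fintype α] [DecidableEq α]

lemma charFunDual_stdComplexGaussianVector (L : StrongDual ℝ (α → ℂ)) :
    charFunDual (stdComplexGaussianVector α) L =
      Complex.exp (-((∑ i, (L (Pi.single i 1) ^ 2 + L (Pi.single i Complex.I) ^ 2)) / 4 : ℝ)) := by
  rw [stdComplexGaussianVector, charFunDual_pi]
  simp_rw [charFunDual_stdComplexGaussian]
  rw [← Complex.exp_sum]
  congr 1
  simp [Finset.sum_div]

/-- A vector of independent `CN(0, 1)` entries is invariant under unitary matrices. -/
lemma measurePreserving_mulVec_stdComplexGaussianVector (M : Matrix α α ℂ) (hM : Mᴴ * M = 1) :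
    MeasurePreserving (fun z => M *ᵥ z) (stdComplexGaussianVector α)
      (stdComplexGaussianVector α) := by
  have hM' : M * Mᴴ = 1 := mul_eq_one_comm.mp hM
  set T : (α → ℂ) →L[ℝ] (α → ℂ) :=
    LinearMap.toContinuousLinearMap ((Matrix.mulVecLin M).restrictScalars ℝ) with hT
  refine ⟨T.continuous.measurable, ?_⟩
  change (stdComplexGaussianVector α).map T = _
  have : IsProbabilityMeasure ((stdComplexGaussianVector α).map T) :=
    Measure.isProbabilityMeasure_map T.continuous.measurable.aemeasurable
  refine Measure.ext_of_charFunDual ?_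
  ext L
  rw [charFunDual_map, charFunDual_stdComplexGaussianVector, charFunDual_stdComplexGaussianVector]
  congr 4
  -- represent `L` by a complex covector
  set a : α → ℂ := fun i => ⟨L (Pi.single i 1), -L (Pi.single i Complex.I)⟩ with ha
  have hL : ∀ z, L z = (a ⬝ᵥ z).re := by
    intro z
    have hz : z = ∑ i, ((z i).re • (Pi.single i 1 : α → ℂ) +
        (z i).im • (Pi.single i Complex.I : α → ℂ)) := by
      ext j
      simp only [Finset.sum_apply, Pi.add_apply, Pi.smul_apply, Pi.single_apply]
      rw [Finset.sum_eq_single j (by intro b _ hb; simp [hb.symm]) (by simp)]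
      simp [Complex.re_add_im]
    conv_lhs => rw [hz]
    simp only [map_sum, map_add, map_smul, dotProduct, Complex.re_sum]
    refine Finset.sum_congr rfl fun i _ => ?_
    simp [ha]; ring
  -- The exponent is the squared norm of the covector. Composition with `M` turns `a` into `a ᵥ* M`,
  -- of the same norm because `M * Mᴴ = 1`.
  have hsum : ∀ b : α → ℂ, ((∑ i, ((b i).re ^ 2 + (b i).im ^ 2) : ℝ) : ℂ) = b ⬝ᵥ star b := by
    intro b
    simp only [dotProduct, Complex.ofReal_sum]
    refine Finset.sum_congr rfl fun i _ => ?_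
    have := Complex.mul_conj (b i)
    rw [Complex.normSq_apply] at this
    simp only [Pi.star_apply, RCLike.star_def, this]
    push_cast; ring
  have e1 : ∀ i, (L.comp T) (Pi.single i 1) ^ 2 + (L.comp T) (Pi.single i Complex.I) ^ 2 =
      ((a ᵥ* M) i).re ^ 2 + ((a ᵥ* M) i).im ^ 2 := by
    intro i
    have t : ∀ z, (L.comp T) z = ((a ᵥ* M) ⬝ᵥ z).re := by
      intro z
      rw [← Matrix.dotProduct_mulVec, ← hL]; rfl
    rw [t, t]
    simp
  have e2 : ∀ i, L (Pi.single i 1) ^ 2 + L (Pi.single i Complex.I) ^ 2 =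
      (a i).re ^ 2 + (a i).im ^ 2 := by
    intro i; simp [ha]
  have : ((∑ i, (((a ᵥ* M) i).re ^ 2 + ((a ᵥ* M) i).im ^ 2) : ℝ) : ℂ) =
      ((∑ i, ((a i).re ^ 2 + (a i).im ^ 2) : ℝ) : ℂ) := by
    rw [hsum, hsum, Matrix.star_vecMul, ← Matrix.dotProduct_mulVec, Matrix.mulVec_mulVec, hM',
      Matrix.one_mulVec]
  simp_rw [e1, e2]
  exact_mod_cast this

variable {ι κ : Type*} [Fintype ι] [Fintype κ] [DecidableEq ι] [DecidableEq κ]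

/-- A matrix of independent `CN(0, 1)` entries is invariant under unitary matrices. -/
lemma measurePreserving_mul_stdComplexGaussianVector (U : Matrix ι ι ℂ) (hU : Uᴴ * U = 1) :
    MeasurePreserving
      (fun z : ι × κ → ℂ => fun p : ι × κ => (U * Matrix.of (Function.curry z)) p.1 p.2)
      (stdComplexGaussianVector (ι × κ)) (stdComplexGaussianVector (ι × κ)) := by
  -- On the flattened matrix, left multiplication by `U` is the unitary U ⊗ 1.
  have h := measurePreserving_mulVec_stdComplexGaussianVector
    (Matrix.kroneckerMap (· * ·) U (1 : Matrix κ κ ℂ)) (by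
      rw [Matrix.conjTranspose_kronecker, ← Matrix.mul_kronecker_mul, hU]; simp)
  convert h using 2 with z
  ext p
  simp [Matrix.mulVec, dotProduct, Matrix.mul_apply, Fintype.sum_prod_type, Matrix.one_apply,
    Function.curry]

omit [DecidableEq α] in
lemma measurePreserving_comp_equiv_stdComplexGaussianVector {β : Type*} [Fintype β] (e : β ≃ α) :
    MeasurePreserving (fun (z : α → ℂ) (b : β) => z (e b)) (stdComplexGaussianVector α)
      (stdComplexGaussianVector β) := by
  have h := (measurePreserving_piCongrLeft (fun _ : α => stdComplexGaussian) e).symm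
  exact h

omit [DecidableEq ι] in
/-- Column `j` and the other columns of a Gaussian matrix are independent Gaussian. -/
lemma measurePreserving_col_stdComplexGaussianVector (j : κ) :
    MeasurePreserving
      (fun z : ι × κ → ℂ => ((fun i => z (i, j), fun p => z (p.1, p.2)) :
        (ι → ℂ) × (ι × {l // l ≠ j} → ℂ)))
      (stdComplexGaussianVector (ι × κ))
      ((stdComplexGaussianVector ι).prod (stdComplexGaussianVector (ι × {l // l ≠ j}))) := by
  let f : ι ⊕ (ι × {l // l ≠ j}) → ι × κ := Sum.elim (fun i => (i, j)) (fun p => (p.1, p.2))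
  have hf : f.Bijective := by
    constructor
    · rintro (a | ⟨a, b, hb⟩) (a' | ⟨a', b', hb'⟩) h <;> simp_all [f]
      exact hb' h.2.symm
    · rintro ⟨a, b⟩
      by_cases hb : b = j
      · exact ⟨Sum.inl a, by simp [f, hb]⟩
      · exact ⟨Sum.inr (a, ⟨b, hb⟩), by simp [f]⟩
  have h1 := measurePreserving_comp_equiv_stdComplexGaussianVector (Equiv.ofBijective f hf)
  have h2 := measurePreserving_sumPiEquivProdPi
    (fun _ : ι ⊕ (ι × {l // l ≠ j}) => stdComplexGaussian)
  exact h2.comp h1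

lemma rayleighLaw_map_uncurry (Nr Nt : ℕ) :
    (rayleighLaw Nr Nt).map (fun H p => H p.1 p.2) =
      stdComplexGaussianVector (Fin Nr × Fin Nt) := by
  -- Over finite index types `infinitePi` is `pi`.
  have h := Measure.infinitePi_map_curry_symm
    (fun (_ : Fin Nr) (_ : Fin Nt) => stdComplexGaussian)
  simp only [Measure.infinitePi_eq_pi] at h
  exact h

end GaussianVectors

/-! ### Algebra of the tail functions. -/

section TailFunctions

/-- The coefficient of `x ^ k` in `exp x * (1 + c * x) ^ m`. -/
noncomputable def mmseCoeff (c : ℝ) (m k : ℕ) : ℝ :=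
  ∑ p ∈ Finset.range (k + 1), ((m.choose (k - p) : ℝ) * c ^ (k - p) / (p.factorial : ℝ))

/-- The complementary distribution function of the normalized MMSE SINR, with `n` receive antennas
and `m` interferers. -/
noncomputable def mmseTail (c : ℝ) (n m : ℕ) (x : ℝ) : ℝ :=
  Real.exp (-x) / (1 + c * x) ^ m * ∑ k ∈ Finset.range n, mmseCoeff c m k * x ^ k

/-- The complementary distribution function of the sum of `n` independent exponentials. -/
noncomputable def erlangTail (n : ℕ) (x : ℝ) : ℝ :=
  Real.exp (-x) * ∑ k ∈ Finset.range n, x ^ k / (k.factorial : ℝ)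

lemma mmseCoeff_nonneg {c : ℝ} (hc : 0 ≤ c) (m k : ℕ) : 0 ≤ mmseCoeff c m k :=
  Finset.sum_nonneg fun _ _ => by positivity

lemma mmseTail_nonneg {c : ℝ} (hc : 0 ≤ c) (n m : ℕ) {x : ℝ} (hx : 0 ≤ x) :
    0 ≤ mmseTail c n m x :=
  mul_nonneg (by positivity)
    (Finset.sum_nonneg fun _ _ => mul_nonneg (mmseCoeff_nonneg hc _ _) (by positivity))

lemma erlangTail_nonneg (n : ℕ) {x : ℝ} (hx : 0 ≤ x) : 0 ≤ erlangTail n x :=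
  mul_nonneg (by positivity) (Finset.sum_nonneg fun _ _ => by positivity)

/-- Term-by-term differentiation telescopes, leaving minus the gamma density. -/
lemma hasDerivAt_erlangTail (n : ℕ) (x : ℝ) :
    HasDerivAt (erlangTail (n + 1)) (-(Real.exp (-x) * x ^ n / n.factorial)) x := by
  induction n with
  | zero =>
    have : erlangTail (0 + 1) = fun x => Real.exp (-x) := by
      ext y; simp [erlangTail]
    rw [this]
    simpa using (hasDerivAt_neg x).exp
  | succ n ih =>
    have : erlangTail (n + 1 + 1) =
        fun y => erlangTail (n + 1) y + Real.exp (-y) * (y ^ (n + 1) / (n + 1).factorial) := by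
      ext y; simp only [erlangTail]; rw [Finset.sum_range_succ _ (n + 1), mul_add]
    rw [this]
    have h := ih.add ((hasDerivAt_neg x).exp.mul
      ((hasDerivAt_pow (n + 1) x).div_const ((n + 1).factorial : ℝ)))
    refine h.congr_deriv ?_
    have hn : (n.factorial : ℝ) ≠ 0 := by positivity
    rw [Nat.factorial_succ]
    push_cast
    field_simp
    simp

lemma sum_range_choose_succ_mul_pow (m r : ℕ) (u : ℝ) :
    ∑ k ∈ Finset.range (r + 1), ((m + 1).choose k : ℝ) * u ^ k =
      (1 + u) * ∑ k ∈ Finset.range (r + 1), (m.choose k : ℝ) * u ^ k -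
        m.choose r * u ^ (r + 1) := by
  induction r with
  | zero => simp
  | succ r ih =>
    rw [Finset.sum_range_succ, ih, Finset.sum_range_succ _ (r + 1), Nat.choose_succ_succ]
    push_cast
    ring

/-- The binomial theorem, with the terms of degree larger than `r` collected. -/
lemma sum_range_choose_mul_pow_add (m r : ℕ) (u : ℝ) :
    ∑ k ∈ Finset.range (r + 1), (m.choose k : ℝ) * u ^ k +
      u ^ (r + 1) * ∑ k ∈ Finset.range m, (k.choose r : ℝ) * (1 + u) ^ (m - 1 - k) =
        (1 + u) ^ m := by
  induction m with
  | zero =>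
    rw [Finset.sum_eq_single 0]
    · simp
    · intro b _ hb
      simp [Nat.choose_eq_zero_of_lt (Nat.pos_of_ne_zero hb)]
    · simp
  | succ m ih =>
    have h : ∑ k ∈ Finset.range (m + 1), (k.choose r : ℝ) * (1 + u) ^ (m + 1 - 1 - k) =
        (1 + u) * (∑ k ∈ Finset.range m, (k.choose r : ℝ) * (1 + u) ^ (m - 1 - k)) +
          m.choose r := by
      rw [Finset.sum_range_succ, Finset.mul_sum]
      congr 1
      · refine Finset.sum_congr rfl fun k hk => ?_
        have hk' := Finset.mem_range.mp hk
        rw [show m + 1 - 1 - k = (m - 1 - k) + 1 by omega, pow_succ]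
        ring
      · simp
    rw [h, sum_range_choose_succ_mul_pow, pow_succ (1 + u) m, ← ih]
    ring

/-- Terms with r > n or r > k vanish through a binomial coefficient, so the range can be made
independent of `k`; `mmseCoeff_sum_identity` needs this to exchange sums. -/
lemma factorial_mul_mmseCoeff (c : ℝ) (n k : ℕ) :
    (k.factorial : ℝ) * mmseCoeff c n k =
      ∑ r ∈ Finset.range (n + 1), (n.choose r : ℝ) * c ^ r * r.factorial * k.choose r := by
  have h1 : (k.factorial : ℝ) * mmseCoeff c n k =
      ∑ r ∈ Finset.range (k + 1), (n.choose r : ℝ) * c ^ r * r.factorial * k.choose r := by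
    rw [mmseCoeff, ← Finset.sum_range_reflect, Finset.mul_sum]
    refine Finset.sum_congr rfl fun r hr => ?_
    have hr' : r ≤ k := Nat.lt_succ_iff.mp (Finset.mem_range.mp hr)
    rw [show k + 1 - 1 - r = k - r by omega, Nat.sub_sub_self hr',
      ← Nat.choose_mul_factorial_mul_factorial hr']
    have : ((k - r).factorial : ℝ) ≠ 0 := by positivity
    push_cast
    field_simp
  have hle : ∀ a b : ℕ, (∀ r, b < r + 1 → r < a →
      (n.choose r : ℝ) * c ^ r * r.factorial * k.choose r = 0) →
      b ≤ a → ∑ r ∈ Finset.range b, (n.choose r : ℝ) * c ^ r * r.factorial * k.choose r =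
      ∑ r ∈ Finset.range a, (n.choose r : ℝ) * c ^ r * r.factorial * k.choose r := by
    intro a b h hab
    refine Finset.sum_subset (by simpa using hab) fun r hr hr' => h r ?_ (by simpa using hr)
    simp at hr'; omega
  rw [h1]
  rcases le_total k n with h | h
  · refine hle _ _ (fun r hr _ => ?_) (by omega)
    rw [Nat.choose_eq_zero_of_lt (by omega : k < r)]; simp
  · refine (hle _ _ (fun r hr _ => ?_) (by omega)).symm
    rw [Nat.choose_eq_zero_of_lt (by omega : n < r)]; simp

/-- Both sums on the left regroup by the factor x^(n-r)/(n-r)!. For each r, the truncated binomial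
sum and its remainder from `sum_range_choose_mul_pow_add` add up to (1 + cx)^m. -/
lemma mmseCoeff_sum_identity (c x : ℝ) (n m : ℕ) :
    ∑ k ∈ Finset.range (n + 1), mmseCoeff c m k * x ^ k +
      c * x ^ (n + 1) / n.factorial *
        ∑ k ∈ Finset.range m, (k.factorial : ℝ) * mmseCoeff c n k * (1 + c * x) ^ (m - 1 - k) =
      (1 + c * x) ^ m * ∑ k ∈ Finset.range (n + 1), x ^ k / (k.factorial : ℝ) := by
  have h1 : ∑ k ∈ Finset.range (n + 1), mmseCoeff c m k * x ^ k =
      ∑ r ∈ Finset.range (n + 1), x ^ (n - r) / ((n - r).factorial : ℝ) *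
        ∑ k ∈ Finset.range (r + 1), (m.choose k : ℝ) * (c * x) ^ k := by
    have := Finset.sum_range_diag_flip (n + 1)
      (fun p k => x ^ p / (p.factorial : ℝ) * ((m.choose k : ℝ) * (c * x) ^ k))
    rw [← Finset.sum_range_reflect (fun r => x ^ (n - r) / _ * _)]
    trans
    swap
    · refine this.trans (Finset.sum_congr rfl fun p hp => ?_)
      have hp' : p ≤ n := Nat.lt_succ_iff.mp (Finset.mem_range.mp hp)
      rw [Finset.mul_sum, show n + 1 - 1 - p = n - p by omega, Nat.sub_sub_self hp',
        show n - p + 1 = n + 1 - p by omega]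
    · refine Finset.sum_congr rfl fun k _ => ?_
      rw [mmseCoeff, Finset.sum_mul]
      refine Finset.sum_congr rfl fun p hp => ?_
      have hp' : p ≤ k := Nat.lt_succ_iff.mp (Finset.mem_range.mp hp)
      conv_lhs => rw [show k = p + (k - p) by omega, pow_add, Nat.add_sub_cancel_left]
      rw [mul_pow]
      ring
  have h2 : c * x ^ (n + 1) / n.factorial *
        ∑ k ∈ Finset.range m, (k.factorial : ℝ) * mmseCoeff c n k * (1 + c * x) ^ (m - 1 - k) =
      ∑ r ∈ Finset.range (n + 1), x ^ (n - r) / ((n - r).factorial : ℝ) *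
        ((c * x) ^ (r + 1) *
          ∑ k ∈ Finset.range m, (k.choose r : ℝ) * (1 + c * x) ^ (m - 1 - k)) := by
    simp_rw [factorial_mul_mmseCoeff, Finset.sum_mul]
    rw [Finset.sum_comm, Finset.mul_sum]
    refine Finset.sum_congr rfl fun r hr => ?_
    have hr' : r ≤ n := Nat.lt_succ_iff.mp (Finset.mem_range.mp hr)
    rw [Finset.mul_sum, Finset.mul_sum, Finset.mul_sum]
    refine Finset.sum_congr rfl fun k _ => ?_
    rw [← Nat.choose_mul_factorial_mul_factorial hr',
      show n + 1 = (n - r) + (r + 1) by omega, pow_add]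
    have : ((n - r).factorial : ℝ) ≠ 0 := by positivity
    have : (n.choose r : ℝ) ≠ 0 := by exact_mod_cast (Nat.choose_pos hr').ne'
    push_cast
    field_simp
    ring
  rw [h1, h2, ← Finset.sum_add_distrib, ← Finset.sum_range_reflect (fun k => x ^ k / _),
    Finset.mul_sum]
  refine Finset.sum_congr rfl fun r _ => ?_
  rw [← mul_add, sum_range_choose_mul_pow_add, show n + 1 - 1 - r = n - r by omega]
  ring

/-- The algebra of the inductive step: the second summand is the integral evaluated in
`integrableOn_and_integral_mmseTail_mul`. -/
lemma mmseTail_succ {c x : ℝ} (hc : 0 ≤ c) (hx : 0 ≤ x) (n m : ℕ) :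
    mmseTail c (n + 1) m x + c * x ^ (n + 1) * Real.exp (-x) / n.factorial *
      ∑ k ∈ Finset.range m, mmseCoeff c n k * (k.factorial / (1 + c * x) ^ (k + 1)) =
      erlangTail (n + 1) x := by
  have hs : (1 + c * x) ≠ 0 := by positivity
  have h := mmseCoeff_sum_identity c x n m
  have h3 : ∑ k ∈ Finset.range m, mmseCoeff c n k * (k.factorial / (1 + c * x) ^ (k + 1)) =
      (∑ k ∈ Finset.range m, (k.factorial : ℝ) * mmseCoeff c n k * (1 + c * x) ^ (m - 1 - k)) /
        (1 + c * x) ^ m := by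
    rw [Finset.sum_div]
    refine Finset.sum_congr rfl fun k hk => ?_
    have hk' := Finset.mem_range.mp hk
    have : (1 + c * x) ^ m = (1 + c * x) ^ (m - 1 - k) * (1 + c * x) ^ (k + 1) := by
      rw [← pow_add]; congr 1; omega
    rw [this]
    field_simp
  have h4 : ∑ k ∈ Finset.range (n + 1), x ^ k / (k.factorial : ℝ) =
      (∑ k ∈ Finset.range (n + 1), mmseCoeff c m k * x ^ k +
      c * x ^ (n + 1) / n.factorial *
        ∑ k ∈ Finset.range m, (k.factorial : ℝ) * mmseCoeff c n k * (1 + c * x) ^ (m - 1 - k)) /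
        (1 + c * x) ^ m := by
    rw [h]; field_simp
  rw [mmseTail, erlangTail, h3, h4]
  field_simp

lemma mmseTail_zero_left (c : ℝ) (m : ℕ) (x : ℝ) : mmseTail c 0 m x = 0 := by
  simp [mmseTail]

end TailFunctions

/-! ### The squared modulus of one complex Gaussian. -/

section Tails

/-- In polar coordinates the density is r e^(-r²)/π, with antiderivative -e^(-r²)/(2π), and the
angle contributes 2π. -/
lemma stdComplexGaussian_lt_norm_sq {t : ℝ} (ht : 0 ≤ t) :
    stdComplexGaussian {z | t < ‖z‖ ^ 2} = ENNReal.ofReal (Real.exp (-t)) := by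
  have hms : MeasurableSet {z : ℂ | t < ‖z‖ ^ 2} :=
    measurableSet_lt measurable_const (by fun_prop)
  have hv : (1 / 2 : ℝ≥0) ≠ 0 := by norm_num
  rw [stdComplexGaussian, Measure.map_apply Complex.measurableEquivRealProd.symm.measurable hms,
    gaussianReal_of_var_ne_zero _ hv, prod_withDensity (by fun_prop) (by fun_prop),
    withDensity_apply _ (Complex.measurableEquivRealProd.symm.measurable hms),
    ← lintegral_indicator (Complex.measurableEquivRealProd.symm.measurable hms),
    ← Measure.volume_eq_prod, ← lintegral_comp_polarCoord_symm]
  have key : ∀ p ∈ polarCoord.target,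
      ENNReal.ofReal p.1 • (Complex.measurableEquivRealProd.symm ⁻¹' {z : ℂ | t < ‖z‖ ^ 2}).indicator
        (fun z => gaussianPDF 0 (1 / 2) z.1 * gaussianPDF 0 (1 / 2) z.2) (polarCoord.symm p) =
      (Set.Ioi (√t)).indicator
        (fun r => ENNReal.ofReal (r * Real.exp (-r ^ 2) / Real.pi)) p.1 * 1 := by
    rintro ⟨r, θ⟩ ⟨hr, -⟩
    have hr : 0 < r := hr
    have hn : ‖Complex.measurableEquivRealProd.symm (polarCoord.symm (r, θ))‖ ^ 2 = r ^ 2 := by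
      rw [Complex.sq_norm, Complex.normSq_apply]
      simp [polarCoord, Complex.measurableEquivRealProd]
      linear_combination r ^ 2 * Real.sin_sq_add_cos_sq θ
    by_cases h : √t < r
    · have h' : t < r ^ 2 := (Real.sqrt_lt' hr).mp h
      rw [Set.indicator_of_mem (by rw [Set.mem_preimage, Set.mem_ofPred_eq, hn]; exact h'),
        Set.indicator_of_mem (by simpa using h),
        gaussianPDF, gaussianPDF, ← ENNReal.ofReal_mul (gaussianPDFReal_nonneg _ _ _), smul_eq_mul,
        ← ENNReal.ofReal_mul hr.le, mul_one]
      congr 1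
      have h2 : (√(2 * Real.pi * ((1 / 2 : ℝ≥0) : ℝ)))⁻¹ * (√(2 * Real.pi * ((1 / 2 : ℝ≥0) : ℝ)))⁻¹ =
          Real.pi⁻¹ := by
        rw [← mul_inv, Real.mul_self_sqrt (by positivity)]
        congr 1
        push_cast; ring
      have h3 : Real.exp (-(r * Real.cos θ - 0) ^ 2 / (2 * ((1 / 2 : ℝ≥0) : ℝ))) *
          Real.exp (-(r * Real.sin θ - 0) ^ 2 / (2 * ((1 / 2 : ℝ≥0) : ℝ))) = Real.exp (-r ^ 2) := by
        rw [← Real.exp_add]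
        congr 1
        push_cast
        linear_combination -r ^ 2 * Real.sin_sq_add_cos_sq θ
      simp only [gaussianPDFReal, polarCoord_symm_apply]
      rw [mul_mul_mul_comm, h2, h3]
      ring
    · have h' : ¬ t < r ^ 2 := fun h' => h ((Real.sqrt_lt' hr).mpr h')
      rw [Set.indicator_of_notMem (by rw [Set.mem_preimage, Set.mem_ofPred_eq, hn]; exact h'),
        Set.indicator_of_notMem (by simpa using h)]
      simp
  rw [setLIntegral_congr_fun polarCoord.open_target.measurableSet key, polarCoord_target,
    Measure.volume_eq_prod, ← Measure.prod_restrict,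
    lintegral_prod_mul (f := (Set.Ioi (√t)).indicator
        (fun r => ENNReal.ofReal (r * Real.exp (-r ^ 2) / Real.pi))) (g := fun _ => 1)
      ((Measurable.indicator (by fun_prop) measurableSet_Ioi).aemeasurable) (by fun_prop),
    lintegral_indicator measurableSet_Ioi, Measure.restrict_restrict measurableSet_Ioi,
    Set.inter_eq_left.mpr (Set.Ioi_subset_Ioi (Real.sqrt_nonneg t))]
  have hd : ∀ r ∈ Set.Ici (√t), HasDerivAt (fun r => -Real.exp (-r ^ 2) / (2 * Real.pi))
      (r * Real.exp (-r ^ 2) / Real.pi) r := by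
    intro r _
    have := (((hasDerivAt_pow 2 r).neg.exp).neg).div_const (2 * Real.pi)
    refine this.congr_deriv ?_
    simp
    field_simp
  have hnn : ∀ r ∈ Set.Ioi (√t), 0 ≤ r * Real.exp (-r ^ 2) / Real.pi := fun r hr => by
    have : 0 ≤ r := (Real.sqrt_nonneg t).trans hr.le
    positivity
  have hlim : Filter.Tendsto (fun r : ℝ => -Real.exp (-r ^ 2) / (2 * Real.pi)) Filter.atTop
      (nhds 0) := by
    have h1 : Filter.Tendsto (fun r : ℝ => Real.exp (-r ^ 2)) Filter.atTop (nhds 0) :=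
      Real.tendsto_exp_neg_atTop_nhds_zero.comp (Filter.tendsto_pow_atTop two_ne_zero)
    simpa using h1.neg.div_const (2 * Real.pi)
  rw [← ofReal_integral_eq_lintegral_ofReal
      (integrableOn_Ioi_deriv_of_nonneg' hd hnn hlim)
      ((ae_restrict_iff' measurableSet_Ioi).mpr (Filter.Eventually.of_forall hnn)),
    integral_Ioi_of_hasDerivAt_of_nonneg' hd hnn hlim]
  simp only [lintegral_const, Measure.restrict_apply MeasurableSet.univ, Set.univ_inter,
    Real.volume_Ioo, one_mul]
  rw [← ENNReal.ofReal_mul' (by linarith [Real.pi_pos]), Real.sq_sqrt ht]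
  congr 1
  have := Real.pi_pos.ne'
  field_simp
  ring

lemma stdComplexGaussian_lt_norm_sq_eq (t : ℝ) :
    stdComplexGaussian {z | t < ‖z‖ ^ 2} = ENNReal.ofReal (Real.exp (-(max t 0))) := by
  rcases le_or_gt 0 t with ht | ht
  · rw [stdComplexGaussian_lt_norm_sq ht, max_eq_left ht]
  · rw [max_eq_right ht.le, show {z : ℂ | t < ‖z‖ ^ 2} = Set.univ from
      Set.eq_univ_of_forall fun z => ht.trans_le (by positivity)]
    simp

end Tails

/-! ### Layer-cake formula and gamma integrals. -/

section LayerCake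

/-- Stated with `lintegral`, so that integrability over `μ` is a consequence and not an assumption.
-/
lemma lintegral_ofReal_intervalIntegral_eq {α : Type*} [MeasurableSpace α] {μ : Measure α}
    {Y : α → ℝ} (hY : Measurable Y) (hY0 : ∀ a, 0 ≤ Y a) {F g : ℝ → ℝ}
    (hF : ∀ t > 0, μ {a | t < Y a} = ENNReal.ofReal (F t)) (hF0 : ∀ t > 0, 0 ≤ F t)
    (hg : ∀ t > 0, IntervalIntegrable g volume 0 t) (hg0 : ∀ t > 0, 0 ≤ g t)
    (hFg : IntegrableOn (fun t => F t * g t) (Set.Ioi 0)) :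
    ∫⁻ a, ENNReal.ofReal (∫ t in 0..Y a, g t) ∂μ =
      ENNReal.ofReal (∫ t in Set.Ioi 0, F t * g t) := by
  have h0 : ∀ᵐ t ∂volume.restrict (Set.Ioi (0 : ℝ)), 0 ≤ g t :=
    (ae_restrict_iff' measurableSet_Ioi).mpr (Filter.Eventually.of_forall hg0)
  have h1 : ∀ᵐ t ∂volume.restrict (Set.Ioi (0 : ℝ)), 0 ≤ F t * g t :=
    (ae_restrict_iff' measurableSet_Ioi).mpr
      (Filter.Eventually.of_forall fun t ht => mul_nonneg (hF0 t ht) (hg0 t ht))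
  rw [lintegral_comp_eq_lintegral_meas_lt_mul μ (Filter.Eventually.of_forall hY0) hY.aemeasurable
    hg h0, ofReal_integral_eq_lintegral_ofReal hFg h1]
  refine setLIntegral_congr_fun measurableSet_Ioi fun t ht => ?_
  rw [hF t ht, ENNReal.ofReal_mul (hF0 t ht)]

lemma integrableOn_and_integral_pow_mul_exp_neg_mul (k : ℕ) {s : ℝ} (hs : 0 < s) :
    IntegrableOn (fun y : ℝ => y ^ k * Real.exp (-(s * y))) (Set.Ioi 0) ∧
      ∫ y in Set.Ioi 0, y ^ k * Real.exp (-(s * y)) = k.factorial / s ^ (k + 1) := by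
  have h : ∫ y in Set.Ioi 0, y ^ k * Real.exp (-(s * y)) = k.factorial / s ^ (k + 1) := by
    have := Real.integral_rpow_mul_exp_neg_mul_Ioi (a := k + 1) (by positivity) hs
    rw [Real.Gamma_nat_eq_factorial] at this
    simp only [add_sub_cancel_right, Real.rpow_natCast] at this
    rw [this, ← Nat.cast_add_one, Real.rpow_natCast, one_div, inv_pow, div_eq_inv_mul]
  refine ⟨?_, h⟩
  -- A non-integrable function would have integral 0, but the value is positive.
  by_contra hn
  have h' := integral_undef hn
  rw [h] at h'
  exact absurd h' (by positivity)

end LayerCake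

/-! ### The squared norm of a Gaussian vector. -/

section Erlang

lemma erlangTail_succ (n : ℕ) (t : ℝ) :
    erlangTail (n + 1) t =
      Real.exp (-t) + ∫ s in 0..t, Real.exp (-t) * ∑ k ∈ Finset.range n, s ^ k / (k.factorial : ℝ) := by
  rw [erlangTail, intervalIntegral.integral_const_mul, intervalIntegral.integral_finsetSum
    (fun k _ => by apply Continuous.intervalIntegrable; fun_prop), Finset.sum_range_succ', mul_add,
    add_comm]
  congr 1
  · simp
  · congr 1
    refine Finset.sum_congr rfl fun k _ => ?_
    rw [intervalIntegral.integral_div, integral_pow, Nat.factorial_succ]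
    push_cast
    field_simp
    simp

lemma stdComplexGaussianVector_fin_lt_sum_norm_sq (n : ℕ) :
    ∀ t : ℝ, 0 ≤ t → stdComplexGaussianVector (Fin n) {h | t < ∑ i, ‖h i‖ ^ 2} =
      ENNReal.ofReal (erlangTail n t) := by
  induction n with
  | zero =>
    intro t ht
    simp [erlangTail, ht.not_gt]
  | succ n ih =>
    intro t ht
    have hmp := measurePreserving_piFinSuccAbove
      (fun _ : Fin (n + 1) => stdComplexGaussian) 0
    have hms : MeasurableSet {p : ℂ × (Fin n → ℂ) | t < ‖p.1‖ ^ 2 + ∑ i, ‖p.2 i‖ ^ 2} :=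
      measurableSet_lt measurable_const (by fun_prop)
    have h1 : stdComplexGaussianVector (Fin (n + 1)) {h | t < ∑ i, ‖h i‖ ^ 2} =
        (stdComplexGaussian.prod (stdComplexGaussianVector (Fin n)))
          {p : ℂ × (Fin n → ℂ) | t < ‖p.1‖ ^ 2 + ∑ i, ‖p.2 i‖ ^ 2} := by
      refine Eq.trans ?_ (hmp.measure_preimage hms.nullMeasurableSet)
      rw [stdComplexGaussianVector]
      congr 1
      ext h
      simp [Fin.sum_univ_succ, MeasurableEquiv.piFinSuccAbove, Fin.tail]
    -- Given that the other coordinates have squared norm S, the first one has squared modulus above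
    -- t - S with probability e^(-max(t-S, 0)) = e^(-t) + ∫₀^S g, which suits the layer-cake
    -- formula.
    set g : ℝ → ℝ := Set.indicator (Set.Iic t) fun s => Real.exp (s - t) with hg
    have hgi : Integrable (Set.indicator (Set.Iic t) fun s => Real.exp (s - t))
        (volume.restrict (Set.Ioi 0)) := by
      rw [integrable_indicator_iff measurableSet_Iic, IntegrableOn,
        Measure.restrict_restrict measurableSet_Iic]
      refine (Continuous.integrableOn_Icc (a := 0) (b := t) (by fun_prop)).mono_set ?_
      intro s hs
      exact ⟨hs.2.le, hs.1⟩
    have h2 : ∀ S : ℝ, 0 ≤ S →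
        Real.exp (-(max (t - S) 0)) = Real.exp (-t) + ∫ s in 0..S, g s := by
      intro S hS
      have hexp : ∀ S' : ℝ, ∫ s in 0..S', Real.exp (s - t) = Real.exp (S' - t) - Real.exp (-t) := by
        intro S'
        rw [intervalIntegral.integral_comp_sub_right (fun s => Real.exp s), integral_exp, zero_sub]
      rcases le_total S t with h | h
      · rw [max_eq_left (by linarith), neg_sub]
        have : ∫ s in 0..S, g s = ∫ s in 0..S, Real.exp (s - t) := by
          refine intervalIntegral.integral_congr fun s hs => ?_
          rw [Set.uIcc_of_le hS] at hs
          exact Set.indicator_of_mem (Set.mem_Iic.mpr (hs.2.trans h)) _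
        rw [this, hexp]; ring
      · have : ∫ s in 0..S, g s = ∫ s in 0..t, Real.exp (s - t) :=
          intervalIntegral.integral_indicator ⟨ht, h⟩
        rw [max_eq_right (by linarith), neg_zero, Real.exp_zero, this, hexp]
        simp
    have hS0 : ∀ h : Fin n → ℂ, 0 ≤ ∑ i, ‖h i‖ ^ 2 := fun h => by positivity
    have hg0 : ∀ s, 0 ≤ g s := fun s => Set.indicator_nonneg (fun _ _ => Real.exp_nonneg _) s
    have h3 : ∀ s, erlangTail n s * g s = Set.indicator (Set.Iic t) (fun s => Real.exp (-t) *
        ∑ k ∈ Finset.range n, s ^ k / (k.factorial : ℝ)) s := by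
      intro s
      by_cases hs : s ≤ t
      · rw [hg, Set.indicator_of_mem (by exact hs), Set.indicator_of_mem (by exact hs), erlangTail,
          mul_right_comm, ← Real.exp_add]
        congr 2; ring
      · rw [hg, Set.indicator_of_notMem (by exact hs), Set.indicator_of_notMem (by exact hs),
          mul_zero]
    have hset : Set.Ioi 0 ∩ (Set.Iic t) = Set.Ioc 0 t := rfl
    have h4 := lintegral_ofReal_intervalIntegral_eq (μ := stdComplexGaussianVector (Fin n))
      (Y := fun h => ∑ i, ‖h i‖ ^ 2) (F := erlangTail n) (g := g) (by fun_prop) hS0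
      (fun s hs => ih s hs.le) (fun s hs => erlangTail_nonneg n hs.le)
      (fun s hs => by
        rw [intervalIntegrable_iff_integrableOn_Ioc_of_le hs.le]
        exact IntegrableOn.mono_set hgi Set.Ioc_subset_Ioi_self)
      (fun s _ => hg0 s)
      (by
        simp_rw [h3]
        rw [IntegrableOn]
        refine (integrable_indicator_iff measurableSet_Iic).mpr ?_
        rw [IntegrableOn, Measure.restrict_restrict measurableSet_Iic, Set.inter_comm, hset]
        exact (Continuous.integrableOn_Icc (by fun_prop)).mono_set Set.Ioc_subset_Icc_self)
    rw [h1, Measure.prod_apply_symm hms]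
    calc _ = ∫⁻ h, (ENNReal.ofReal (Real.exp (-t)) +
          ENNReal.ofReal (∫ s in 0..∑ i, ‖h i‖ ^ 2, g s)) ∂stdComplexGaussianVector (Fin n) := by
          refine lintegral_congr fun h => ?_
          rw [← ENNReal.ofReal_add (Real.exp_nonneg _)
            (intervalIntegral.integral_nonneg (hS0 h) fun s _ => hg0 s), ← h2 _ (hS0 h),
            ← stdComplexGaussian_lt_norm_sq_eq]
          congr 1
          ext z
          simp [sub_lt_iff_lt_add]
      _ = ENNReal.ofReal (erlangTail (n + 1) t) := by
          rw [lintegral_add_left measurable_const, h4, lintegral_const, measure_univ, mul_one,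
            erlangTail_succ, ENNReal.ofReal_add (Real.exp_nonneg _)
            (intervalIntegral.integral_nonneg ht fun s hs => mul_nonneg (Real.exp_nonneg _)
              (Finset.sum_nonneg fun k _ => div_nonneg (pow_nonneg hs.1 _) (by positivity)))]
          congr 2
          simp_rw [h3]
          rw [setIntegral_indicator measurableSet_Iic, hset, intervalIntegral.integral_of_le ht]

lemma stdComplexGaussianVector_lt_sum_norm_sq {ι : Type*} [Fintype ι] {t : ℝ} (ht : 0 ≤ t) :
    stdComplexGaussianVector ι {h | t < ∑ i, ‖h i‖ ^ 2} =
      ENNReal.ofReal (erlangTail (Fintype.card ι) t) := by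
  let e := Fintype.equivFin ι
  rw [← stdComplexGaussianVector_fin_lt_sum_norm_sq _ t ht,
    ← (measurePreserving_comp_equiv_stdComplexGaussianVector e).measure_preimage
      (measurableSet_lt measurable_const (by fun_prop)).nullMeasurableSet]
  congr 1
  ext h
  simp [← e.sum_comp]

end Erlang

/-! ### The law of the normalized SINR. -/

section SinrLaw

/-- The fundamental theorem of calculus in y; it puts `erlangTail` in a form to which the layer-cake
formula applies. -/
lemma erlangTail_add_intervalIntegral (c x Y : ℝ) (n : ℕ) :
    erlangTail (n + 1) (x * (1 + c * Y)) +
      ∫ y in 0..Y, x * c * (Real.exp (-(x * (1 + c * y))) * (x * (1 + c * y)) ^ n / n.factorial) =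
      erlangTail (n + 1) x := by
  have hd : ∀ y : ℝ, HasDerivAt (fun y => -erlangTail (n + 1) (x * (1 + c * y)))
      (x * c * (Real.exp (-(x * (1 + c * y))) * (x * (1 + c * y)) ^ n / n.factorial)) y := by
    intro y
    have h1 : HasDerivAt (fun y : ℝ => x * (1 + c * y)) (x * c) y := by
      simpa using (((hasDerivAt_id y).const_mul c).const_add 1).const_mul x
    have h2 := ((hasDerivAt_erlangTail n (x * (1 + c * y))).comp y h1).neg
    refine h2.congr_deriv ?_
    ring
  rw [intervalIntegral.integral_eq_sub_of_hasDerivAt (fun y _ => hd y)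
    (by apply Continuous.intervalIntegrable; fun_prop)]
  simp

/-- The power (1 + cy)^n of the Erlang density cancels the denominator of `mmseTail c m n y`; the
exponentials merge into e^(-x) e^(-(1+cx)y), leaving gamma integrals. -/
lemma integrableOn_and_integral_mmseTail_mul {c x : ℝ} (hc : 0 ≤ c) (hx : 0 ≤ x) (n m : ℕ) :
    IntegrableOn (fun y => mmseTail c m n y *
      (x * c * (Real.exp (-(x * (1 + c * y))) * (x * (1 + c * y)) ^ n / n.factorial))) (Set.Ioi 0) ∧
    ∫ y in Set.Ioi 0, mmseTail c m n y *
      (x * c * (Real.exp (-(x * (1 + c * y))) * (x * (1 + c * y)) ^ n / n.factorial)) =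
    c * x ^ (n + 1) * Real.exp (-x) / n.factorial *
      ∑ k ∈ Finset.range m, mmseCoeff c n k * (k.factorial / (1 + c * x) ^ (k + 1)) := by
  have hs : 0 < 1 + c * x := by positivity
  have heq : Set.EqOn (fun y => c * x ^ (n + 1) * Real.exp (-x) / n.factorial *
      ∑ k ∈ Finset.range m, mmseCoeff c n k * (y ^ k * Real.exp (-((1 + c * x) * y))))
      (fun y => mmseTail c m n y *
      (x * c * (Real.exp (-(x * (1 + c * y))) * (x * (1 + c * y)) ^ n / n.factorial)))
      (Set.Ioi 0) := by
    intro y hy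
    have hy : 0 < y := hy
    have h1 : (1 + c * y) ≠ 0 := by positivity
    have h2 : Real.exp (-((1 + c * x) * y)) * Real.exp (-x) =
        Real.exp (-y) * Real.exp (-(x * (1 + c * y))) := by
      rw [← Real.exp_add, ← Real.exp_add]; congr 1; ring
    have h3 : ∑ k ∈ Finset.range m, mmseCoeff c n k * (y ^ k * Real.exp (-((1 + c * x) * y))) =
        Real.exp (-((1 + c * x) * y)) * ∑ k ∈ Finset.range m, mmseCoeff c n k * y ^ k := by
      rw [Finset.mul_sum]
      exact Finset.sum_congr rfl fun k _ => by ring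
    simp only [h3, mmseTail]
    rw [mul_pow]
    field_simp
    linear_combination (∑ k ∈ Finset.range m, mmseCoeff c n k * y ^ k) * c * x ^ (n + 1) * h2
  have hI : ∀ k ∈ Finset.range m, IntegrableOn
      (fun y => mmseCoeff c n k * (y ^ k * Real.exp (-((1 + c * x) * y)))) (Set.Ioi 0) :=
    fun k _ => (integrableOn_and_integral_pow_mul_exp_neg_mul k hs).1.const_mul _
  refine ⟨IntegrableOn.congr_fun (Integrable.const_mul (integrable_finsetSum _ hI) _) heq
    measurableSet_Ioi, ?_⟩
  rw [← setIntegral_congr_fun measurableSet_Ioi heq, integral_const_mul, integral_finsetSum _ hI]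
  congr 1
  refine Finset.sum_congr rfl fun k _ => ?_
  rw [integral_const_mul, (integrableOn_and_integral_pow_mul_exp_neg_mul k hs).2]

lemma lintegral_erlangTail {α : Type*} [MeasurableSpace α] {μ : Measure α} [IsProbabilityMeasure μ]
    {Y : α → ℝ} (hY : Measurable Y) (hY0 : ∀ a, 0 ≤ Y a) {c x : ℝ} (hc : 0 ≤ c) (hx : 0 ≤ x)
    {n m : ℕ} (hF : ∀ t > 0, μ {a | t < Y a} = ENNReal.ofReal (mmseTail c m n t)) :
    ∫⁻ a, ENNReal.ofReal (erlangTail (n + 1) (x * (1 + c * Y a))) ∂μ =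
      ENNReal.ofReal (mmseTail c (n + 1) m x) := by
  have hI := integrableOn_and_integral_mmseTail_mul hc hx n m
  have hg0 : ∀ t : ℝ, 0 ≤ t →
      0 ≤ x * c * (Real.exp (-(x * (1 + c * t))) * (x * (1 + c * t)) ^ n / n.factorial) :=
    fun t ht => by positivity
  have h1 := lintegral_ofReal_intervalIntegral_eq hY hY0 hF
    (fun t ht => mmseTail_nonneg hc m n (le_of_lt ht))
    (g := fun y => x * c * (Real.exp (-(x * (1 + c * y))) * (x * (1 + c * y)) ^ n / n.factorial))
    (fun t _ => by apply Continuous.intervalIntegrable; fun_prop)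
    (fun t ht => hg0 t (le_of_lt ht)) hI.1
  rw [hI.2] at h1
  have hE : Measurable fun a => ENNReal.ofReal (erlangTail (n + 1) (x * (1 + c * Y a))) := by
    have : Continuous (erlangTail (n + 1)) := by unfold erlangTail; fun_prop
    exact (this.measurable.comp (by fun_prop)).ennreal_ofReal
  have h2 : ∫⁻ a, ENNReal.ofReal (erlangTail (n + 1) (x * (1 + c * Y a))) ∂μ +
      ∫⁻ a, ENNReal.ofReal (∫ y in 0..Y a,
        x * c * (Real.exp (-(x * (1 + c * y))) * (x * (1 + c * y)) ^ n / n.factorial)) ∂μ =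
      ENNReal.ofReal (erlangTail (n + 1) x) := by
    rw [← lintegral_add_left hE]
    have : ∀ a, ENNReal.ofReal (erlangTail (n + 1) (x * (1 + c * Y a))) +
        ENNReal.ofReal (∫ y in 0..Y a,
          x * c * (Real.exp (-(x * (1 + c * y))) * (x * (1 + c * y)) ^ n / n.factorial)) =
        ENNReal.ofReal (erlangTail (n + 1) x) := by
      intro a
      have := hY0 a
      rw [← ENNReal.ofReal_add (erlangTail_nonneg _ (by positivity))
        (intervalIntegral.integral_nonneg (hY0 a) fun y hy => hg0 y hy.1),
        erlangTail_add_intervalIntegral]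
    rw [lintegral_congr this, lintegral_const, measure_univ, mul_one]
  -- Both sides now carry the same finite integral term, which is cancelled in `ℝ≥0∞`.
  rw [h1, ← mmseTail_succ hc hx n m, ENNReal.ofReal_add (mmseTail_nonneg hc _ _ hx)] at h2
  · exact (ENNReal.add_left_inj ENNReal.ofReal_ne_top).mp h2
  · refine mul_nonneg (by positivity) (Finset.sum_nonneg fun k _ => ?_)
    exact mul_nonneg (mmseCoeff_nonneg hc _ _) (by positivity)

variable {ι κ : Type*} [Fintype ι] [Fintype κ] [DecidableEq ι] [DecidableEq κ]

omit [DecidableEq κ] in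
lemma continuous_regularizedForm_curry {c : ℝ} (hc : 0 ≤ c) :
    Continuous fun p : (ι → ℂ) × (ι × κ → ℂ) =>
      regularizedForm c p.1 (Matrix.of (Function.curry p.2)) := by
  refine (continuous_regularizedForm hc).comp (continuous_fst.prodMk ?_)
  exact continuous_matrix fun i j => (continuous_apply (i, j)).comp continuous_snd

/-- For a fixed vector, the law of the regularized form depends on the length of the vector only. -/
lemma stdComplexGaussianVector_lt_regularizedForm_eq {c : ℝ} (hc : 0 ≤ c) (h : ι → ℂ) (i : ι)
    (x : ℝ) :
    stdComplexGaussianVector (ι × κ)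
        {z | x < regularizedForm c h (Matrix.of (Function.curry z))} =
      stdComplexGaussianVector (ι × κ)
        {z | x < (∑ l, ‖h l‖ ^ 2) *
          regularizedForm c (Pi.single i 1) (Matrix.of (Function.curry z))} := by
  obtain ⟨U, hU, hUh⟩ := exists_unitary_mulVec_eq_single h i
  have hms : MeasurableSet {z : ι × κ → ℂ | x < (∑ l, ‖h l‖ ^ 2) *
      regularizedForm c (Pi.single i 1) (Matrix.of (Function.curry z))} := by
    refine measurableSet_lt measurable_const (Measurable.const_mul ?_ _)
    exact ((continuous_regularizedForm_curry hc).comp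
      (continuous_const.prodMk continuous_id)).measurable
  rw [← (measurePreserving_mul_stdComplexGaussianVector U hU).measure_preimage
    hms.nullMeasurableSet]
  congr 1
  ext z
  have : regularizedForm c h (Matrix.of (Function.curry z)) = (∑ l, ‖h l‖ ^ 2) *
      regularizedForm c (Pi.single i 1) (U * Matrix.of (Function.curry z)) := by
    rw [← regularizedForm_unitary c h _ U hU, hUh, regularizedForm_smul,
      Real.sq_sqrt (by positivity)]
  exact iff_of_eq (congrArg (x < ·) this)

omit [DecidableEq κ] in
/-- Separation of one row from the others, which are transposed. -/
lemma measurePreserving_row_stdComplexGaussianVector (i : ι) :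
    MeasurePreserving
      (fun z : ι × κ → ℂ => ((fun j => z (i, j), fun p => z (p.2, p.1)) :
        (κ → ℂ) × (κ × {l // l ≠ i} → ℂ)))
      (stdComplexGaussianVector (ι × κ))
      ((stdComplexGaussianVector κ).prod (stdComplexGaussianVector (κ × {l // l ≠ i}))) :=
  (measurePreserving_col_stdComplexGaussianVector (ι := κ) i).comp
    (measurePreserving_comp_equiv_stdComplexGaussianVector (Equiv.prodComm κ ι))

/-- The complementary distribution function of the normalized MMSE SINR. -/
theorem stdComplexGaussianVector_prod_lt_regularizedForm {c : ℝ} (hc : 0 ≤ c) {ι κ : Type}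
    [Fintype ι] [Fintype κ] [DecidableEq ι] [DecidableEq κ] {x : ℝ} (hx : 0 ≤ x) :
    ((stdComplexGaussianVector ι).prod (stdComplexGaussianVector (ι × κ)))
        {p | x < regularizedForm c p.1 (Matrix.of (Function.curry p.2))} =
      ENNReal.ofReal (mmseTail c (Fintype.card ι) (Fintype.card κ) x) := by
  -- Bordering exchanges the roles of `ι` and `κ` and removes one index, so the induction runs on
  -- the total size with both types generalized (hence in one universe).
  induction hN : Fintype.card ι + Fintype.card κ using Nat.strong_induction_on
    generalizing ι κ x with
  | _ N ih =>
  rcases isEmpty_or_nonempty ι with hι | ⟨⟨i⟩⟩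
  · simp [regularizedForm, mmseTail_zero_left, hx.not_gt]
  have hcard : Fintype.card ι = Fintype.card {l // l ≠ i} + 1 := by
    have := Fintype.card_pos_iff.mpr ⟨i⟩
    rw [Fintype.card_subtype_compl, Fintype.card_subtype_eq]
    omega
  set Y : (ι × κ → ℂ) → ℝ := fun z => regularizedForm c (fun j => z (i, j))
    (Matrix.of fun (j : κ) (l : {l // l ≠ i}) => z (l, j)) with hY
  have hmp := measurePreserving_row_stdComplexGaussianVector (κ := κ) i
  have hYm : Measurable Y :=
    (continuous_regularizedForm_curry (ι := κ) (κ := {l // l ≠ i}) hc).measurable.comp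
      hmp.measurable
  have hY0 : ∀ z, 0 ≤ Y z := fun z => regularizedForm_nonneg hc _ _
  have hYlaw : ∀ t > 0, stdComplexGaussianVector (ι × κ) {z | t < Y z} =
      ENNReal.ofReal (mmseTail c (Fintype.card κ) (Fintype.card {l // l ≠ i}) t) := by
    intro t ht
    rw [← ih (Fintype.card κ + Fintype.card {l // l ≠ i}) (by omega) (ι := κ)
      (κ := {l // l ≠ i}) (le_of_lt ht) rfl]
    exact hmp.measure_preimage (measurableSet_lt measurable_const
      (continuous_regularizedForm_curry hc).measurable).nullMeasurableSet
  have hms : MeasurableSet {p : (ι → ℂ) × (ι × κ → ℂ) |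
      x < regularizedForm c p.1 (Matrix.of (Function.curry p.2))} :=
    measurableSet_lt measurable_const (continuous_regularizedForm_curry hc).measurable
  have hms' : MeasurableSet {p : (ι → ℂ) × (ι × κ → ℂ) |
      x < (∑ l, ‖p.1 l‖ ^ 2) *
        regularizedForm c (Pi.single i 1) (Matrix.of (Function.curry p.2))} := by
    refine measurableSet_lt measurable_const (Measurable.mul (by fun_prop) ?_)
    exact ((continuous_regularizedForm_curry hc).comp
      (continuous_const.prodMk continuous_snd)).measurable
  rw [Measure.prod_apply hms]
  calc _ = ∫⁻ h, stdComplexGaussianVector (ι × κ) (Prod.mk h ⁻¹' {p : (ι → ℂ) × (ι × κ → ℂ) |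
          x < (∑ l, ‖p.1 l‖ ^ 2) *
            regularizedForm c (Pi.single i 1) (Matrix.of (Function.curry p.2))})
          ∂stdComplexGaussianVector ι :=
        lintegral_congr fun h => stdComplexGaussianVector_lt_regularizedForm_eq hc h i x
    _ = ∫⁻ z, ENNReal.ofReal (erlangTail (Fintype.card ι) (x * (1 + c * Y z)))
          ∂stdComplexGaussianVector (ι × κ) := by
        -- Tonelli: with the matrix fixed, the event becomes a tail event for the squared norm of h.
        rw [← Measure.prod_apply hms', Measure.prod_apply_symm hms']
        refine lintegral_congr fun z => ?_
        have hpos : 0 < 1 + c * Y z := by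
          have := mul_nonneg hc (hY0 z); linarith
        rw [← stdComplexGaussianVector_lt_sum_norm_sq (by positivity)]
        congr 1
        ext h
        have : regularizedForm c (Pi.single i 1) (Matrix.of (Function.curry z)) =
            (1 + c * Y z)⁻¹ := regularizedForm_single hc i _
        change x < (∑ l, ‖h l‖ ^ 2) * _ ↔ x * (1 + c * Y z) < ∑ l, ‖h l‖ ^ 2
        rw [this, ← div_eq_mul_inv, lt_div_iff₀ hpos]
    _ = _ := by
        rw [hcard]
        exact lintegral_erlangTail hYm hY0 hc hx hYlaw

end SinrLaw

/-! ### The expected logarithm and incomplete gamma functions. -/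

section SumRate

lemma mmseBeta_eq_mmseCoeff {Nt : ℕ} (hNt : 1 ≤ Nt) {ρ : ℝ} (hρ : 0 < ρ) (k : ℕ) :
    mmseBeta Nt ρ k = mmseCoeff (ρ / Nt) (Nt - 1) k := by
  have hN : (0 : ℝ) < Nt := by exact_mod_cast hNt
  have hc : ρ / Nt ≠ 0 := by positivity
  rw [mmseBeta, mmseCoeff, Finset.mul_sum]
  have hsub : Finset.Icc (k + 1 - Nt) k ⊆ Finset.range (k + 1) := fun p hp =>
    Finset.mem_range.mpr (Nat.lt_succ_iff.mpr (Finset.mem_Icc.mp hp).2)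
  rw [← Finset.sum_subset hsub]
  · refine Finset.sum_congr rfl fun p hp => ?_
    have hp' := (Finset.mem_Icc.mp hp).2
    have : (ρ / Nt) ^ k = (ρ / Nt) ^ (k - p) * (ρ / Nt) ^ p := by
      rw [← pow_add]; congr 1; omega
    rw [this]
    have := pow_ne_zero p hc
    generalize ρ / Nt = c at *
    field_simp
  · intro p hp hp'
    simp only [Finset.mem_range, Finset.mem_Icc, not_and, not_le] at hp hp'
    -- Indices p below k + 1 - Nt have k - p > Nt - 1.
    rw [Nat.choose_eq_zero_of_lt (by by_contra h; exact absurd (hp' (by omega)) (by omega))]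
    simp

lemma integrableOn_pow_mul_exp_neg_div {c : ℝ} (hc : 0 ≤ c) (k N : ℕ) :
    IntegrableOn (fun t => t ^ k * Real.exp (-t) / (1 + c * t) ^ N) (Set.Ioi 0) := by
  have h := (integrableOn_and_integral_pow_mul_exp_neg_mul k one_pos).1
  simp only [one_mul] at h
  refine Integrable.mono' h ?_ ?_
  · exact Measurable.aestronglyMeasurable (by fun_prop)
  · refine (ae_restrict_iff' measurableSet_Ioi).mpr (Filter.Eventually.of_forall fun t ht => ?_)
    have ht : 0 < t := ht
    rw [Real.norm_of_nonneg (by positivity)]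
    exact div_le_self (by positivity) (one_le_pow₀ (by nlinarith [mul_nonneg hc ht.le]))

lemma integrableOn_rpow_mul_exp_neg {a : ℝ} (ha : 0 < a) (q N : ℕ) :
    IntegrableOn (fun t : ℝ => t ^ (1 - (N : ℝ) + q - 1) * Real.exp (-t)) (Set.Ioi a) := by
  -- Away from 0, t^(-N) is at most a^(-N), so t^q e^(-t) / a^N dominates.
  have h := ((integrableOn_and_integral_pow_mul_exp_neg_mul q one_pos).1.mono_set
    (Set.Ioi_subset_Ioi ha.le)).div_const (a ^ N)
  simp only [one_mul] at h
  refine Integrable.mono' h ?_ ?_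
  · exact Measurable.aestronglyMeasurable (by fun_prop)
  · refine (ae_restrict_iff' measurableSet_Ioi).mpr (Filter.Eventually.of_forall fun t ht => ?_)
    have ht' : a < t := ht
    have ht0 : 0 < t := ha.trans ht'
    rw [Real.norm_of_nonneg (by positivity), show 1 - (N : ℝ) + q - 1 = (q : ℝ) - N by ring,
      Real.rpow_sub ht0, Real.rpow_natCast, Real.rpow_natCast, div_mul_eq_mul_div]
    gcongr

/-- The shift u = t + 1/c turns 1 + ct into cu, and (u - 1/c)^k is expanded by the binomial theorem.
-/
lemma integral_pow_mul_exp_neg_div {c : ℝ} (hc : 0 < c) (k N : ℕ) :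
    ∫ t in Set.Ioi 0, t ^ k * Real.exp (-t) / (1 + c * t) ^ N =
      Real.exp c⁻¹ * c⁻¹ ^ N * c⁻¹ ^ k * ∑ q ∈ Finset.range (k + 1),
        (k.choose q : ℝ) * (-1) ^ (k - q) * c ^ q *
          upperIncompleteGamma (1 - (N : ℝ) + q) c⁻¹ := by
  have ha : 0 < c⁻¹ := by positivity
  have h1 : ∫ t in Set.Ioi 0, t ^ k * Real.exp (-t) / (1 + c * t) ^ N =
      ∫ u in Set.Ioi c⁻¹, (u - c⁻¹) ^ k * Real.exp (-(u - c⁻¹)) / (1 + c * (u - c⁻¹)) ^ N := by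
    rw [← (measurePreserving_sub_right volume c⁻¹).setIntegral_preimage_emb
      (MeasurableEquiv.subRight c⁻¹).measurableEmbedding]
    simp
  have h2 : Set.EqOn
      (fun u => (u - c⁻¹) ^ k * Real.exp (-(u - c⁻¹)) / (1 + c * (u - c⁻¹)) ^ N)
      (fun u => Real.exp c⁻¹ * c⁻¹ ^ N * c⁻¹ ^ k * ∑ q ∈ Finset.range (k + 1),
        (k.choose q : ℝ) * (-1) ^ (k - q) * c ^ q *
          (u ^ (1 - (N : ℝ) + q - 1) * Real.exp (-u))) (Set.Ioi c⁻¹) := by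
    intro u hu
    have hu0 : 0 < u := ha.trans hu
    have e1 : 1 + c * (u - c⁻¹) = c * u := by field_simp; ring
    have e2 : Real.exp (-(u - c⁻¹)) = Real.exp c⁻¹ * Real.exp (-u) := by
      rw [← Real.exp_add]; congr 1; ring
    simp only [e1, e2]
    rw [sub_eq_add_neg, add_pow, Finset.sum_mul, Finset.sum_div, Finset.mul_sum]
    refine Finset.sum_congr rfl fun q hq => ?_
    have hq' : q ≤ k := Nat.lt_succ_iff.mp (Finset.mem_range.mp hq)
    have e3 : c⁻¹ ^ k = c⁻¹ ^ (k - q) * c⁻¹ ^ q := by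
      rw [← pow_add]; congr 1; omega
    rw [show 1 - (N : ℝ) + q - 1 = (q : ℝ) - N by ring, Real.rpow_sub hu0, Real.rpow_natCast,
      Real.rpow_natCast, e3, neg_pow c⁻¹, mul_pow]
    simp only [inv_pow]
    field_simp
  have hI := fun q (_ : q ∈ Finset.range (k + 1)) =>
    (integrableOn_rpow_mul_exp_neg ha q N).const_mul ((k.choose q : ℝ) * (-1) ^ (k - q) * c ^ q)
  rw [h1, setIntegral_congr_fun measurableSet_Ioi h2, integral_const_mul,
    integral_finsetSum _ hI]
  congr 1
  refine Finset.sum_congr rfl fun q _ => ?_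
  rw [integral_const_mul, upperIncompleteGamma]

/-- The derivative of log(1 + ct) raises the exponent of the denominator from m to m + 1; with m =
Nt - 1 this gives the first argument 1 - Nt + q. -/
lemma integrableOn_and_integral_mmseTail_div {c : ℝ} (hc : 0 < c) (n m : ℕ) :
    IntegrableOn (fun t => mmseTail c n m t * (c / (1 + c * t))) (Set.Ioi 0) ∧
    ∫ t in Set.Ioi 0, mmseTail c n m t * (c / (1 + c * t)) =
      c⁻¹ ^ m * Real.exp c⁻¹ * ∑ k ∈ Finset.range n, mmseCoeff c m k * c⁻¹ ^ k *
        ∑ q ∈ Finset.range (k + 1), (k.choose q : ℝ) * (-1) ^ (k - q) * c ^ q *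
          upperIncompleteGamma (1 - ((m + 1 : ℕ) : ℝ) + q) c⁻¹ := by
  have heq : Set.EqOn
      (fun t => ∑ k ∈ Finset.range n,
        c * mmseCoeff c m k * (t ^ k * Real.exp (-t) / (1 + c * t) ^ (m + 1)))
      (fun t => mmseTail c n m t * (c / (1 + c * t))) (Set.Ioi 0) := by
    intro t ht
    have ht : 0 < t := ht
    have : (1 + c * t) ≠ 0 := by positivity
    simp only [mmseTail]
    rw [Finset.mul_sum, Finset.sum_mul]
    refine Finset.sum_congr rfl fun k _ => ?_
    rw [pow_succ]
    field_simp
  have hI := fun k (_ : k ∈ Finset.range n) =>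
    (integrableOn_pow_mul_exp_neg_div hc.le k (m + 1)).const_mul (c * mmseCoeff c m k)
  refine ⟨IntegrableOn.congr_fun (integrable_finsetSum _ hI) heq measurableSet_Ioi, ?_⟩
  rw [← setIntegral_congr_fun measurableSet_Ioi heq, integral_finsetSum _ hI, Finset.mul_sum]
  refine Finset.sum_congr rfl fun k _ => ?_
  rw [integral_const_mul, integral_pow_mul_exp_neg_div hc, pow_succ]
  have : c ≠ 0 := hc.ne'
  field_simp

lemma log_one_add_mul_eq_intervalIntegral {c Y : ℝ} (hc : 0 ≤ c) (hY : 0 ≤ Y) :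
    ∫ t in 0..Y, c / (1 + c * t) = Real.log (1 + c * Y) := by
  have hpos : ∀ t ∈ Set.uIcc 0 Y, 1 + c * t ≠ 0 := by
    intro t ht
    rw [Set.uIcc_of_le hY] at ht
    have := mul_nonneg hc ht.1
    positivity
  rw [intervalIntegral.integral_eq_sub_of_hasDerivAt (f := fun t => Real.log (1 + c * t))]
  · simp
  · intro t ht
    have h : HasDerivAt (fun t : ℝ => 1 + c * t) c t := by
      simpa using ((hasDerivAt_id t).const_mul c).const_add 1
    exact h.log (hpos t ht)
  · exact ContinuousOn.intervalIntegrable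
      (continuousOn_const.div (by fun_prop) hpos)

/-- The expectation of `log (1 + c Y)` from the complementary distribution function of `Y`. -/
lemma integrable_and_integral_log_one_add {α : Type*} [MeasurableSpace α] {μ : Measure α}
    {Y : α → ℝ} (hY : Measurable Y) (hY0 : ∀ a, 0 ≤ Y a) {c : ℝ} (hc : 0 < c) {n m : ℕ}
    (hF : ∀ t > 0, μ {a | t < Y a} = ENNReal.ofReal (mmseTail c n m t)) :
    Integrable (fun a => Real.log (1 + c * Y a)) μ ∧
      ∫ a, Real.log (1 + c * Y a) ∂μ =
        ∫ t in Set.Ioi 0, mmseTail c n m t * (c / (1 + c * t)) := by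
  have hg0 : ∀ t : ℝ, 0 < t → 0 ≤ c / (1 + c * t) := fun t ht => by positivity
  have h1 := lintegral_ofReal_intervalIntegral_eq hY hY0 hF
    (fun t ht => mmseTail_nonneg hc.le n m (le_of_lt ht)) (g := fun t => c / (1 + c * t))
    (fun t ht => ContinuousOn.intervalIntegrable (continuousOn_const.div (by fun_prop)
      fun s hs => by
        rw [Set.uIcc_of_le (le_of_lt ht)] at hs
        have := mul_nonneg hc.le hs.1
        positivity))
    hg0 (integrableOn_and_integral_mmseTail_div hc n m).1
  simp_rw [log_one_add_mul_eq_intervalIntegral hc.le (hY0 _)] at h1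
  have hlog0 : ∀ a, 0 ≤ Real.log (1 + c * Y a) := fun a =>
    Real.log_nonneg (by nlinarith [mul_nonneg hc.le (hY0 a)])
  have hm : AEStronglyMeasurable (fun a => Real.log (1 + c * Y a)) μ :=
    Measurable.aestronglyMeasurable (by fun_prop)
  refine ⟨?_, ?_⟩
  -- For a nonnegative function, the finite value of the `lintegral` is integrability.
  · rw [← lintegral_ofReal_ne_top_iff_integrable hm (Filter.Eventually.of_forall hlog0), h1]
    exact ENNReal.ofReal_ne_top
  · rw [integral_eq_lintegral_of_nonneg_ae (Filter.Eventually.of_forall hlog0) hm, h1,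
      ENNReal.toReal_ofReal]
    exact setIntegral_nonneg measurableSet_Ioi fun t ht =>
      mul_nonneg (mmseTail_nonneg hc.le n m (le_of_lt ht)) (hg0 t ht)

lemma normalizedMmseSINR_eq_regularizedForm {Nr Nt : ℕ} (hNt : 1 ≤ Nt) {ρ : ℝ} (hρ : 0 < ρ)
    (H : Matrix (Fin Nr) (Fin Nt) ℂ) (i : Fin Nt) :
    normalizedMmseSINR ρ H i = regularizedForm (ρ / Nt) (H.col i) (interferenceMatrix H i) := by
  have hN : (Nt : ℝ) ≠ 0 := by positivity
  change Nt * (ρ / Nt * regularizedForm (ρ / Nt) (H.col i) (interferenceMatrix H i)) / ρ = _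
  field_simp

lemma hasLaw_col_prod_interference {Nr Nt : ℕ} {Ω : Type*} [MeasurableSpace Ω] {P : Measure Ω}
    {H : Ω → Fin Nr → Fin Nt → ℂ} (hH : HasLaw H (rayleighLaw Nr Nt) P) (i : Fin Nt) :
    HasLaw (fun ω => ((fun r => H ω r i, fun p => H ω p.1 p.2) :
        (Fin Nr → ℂ) × (Fin Nr × {j // j ≠ i} → ℂ)))
      ((stdComplexGaussianVector (Fin Nr)).prod
        (stdComplexGaussianVector (Fin Nr × {j // j ≠ i}))) P := by
  have h1 : MeasurePreserving (fun (H : Fin Nr → Fin Nt → ℂ) (p : Fin Nr × Fin Nt) => H p.1 p.2)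
      (rayleighLaw Nr Nt) (stdComplexGaussianVector (Fin Nr × Fin Nt)) :=
    ⟨by fun_prop, rayleighLaw_map_uncurry Nr Nt⟩
  exact ((measurePreserving_col_stdComplexGaussianVector i).comp h1).hasLaw.comp hH

end SumRate

end MimoScheduling

open MimoScheduling in
theorem mainTheorem4 {Nr Nt : ℕ} (hNr : 1 ≤ Nr) (hNt : 1 ≤ Nt) {ρ : ℝ} (hρ : 0 < ρ)
    {Ω : Type*} [MeasurableSpace Ω] (P : Measure Ω) [IsProbabilityMeasure P]
    (H : Ω → Fin Nr → Fin Nt → ℂ)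
    (hH : HasLaw H (MimoScheduling.rayleighLaw Nr Nt) P)
    (i : Fin Nt) :
    Integrable
      (fun ω => Real.logb 2
        (1 + ρ / Nt * MimoScheduling.normalizedMmseSINR ρ (Matrix.of (H ω)) i)) P ∧
    MimoScheduling.roundRobinSumRate P Nt ρ
        (fun ω => MimoScheduling.normalizedMmseSINR ρ (Matrix.of (H ω)) i) =
      Real.logb 2 (Real.exp 1) * ((Nt : ℝ) / ρ) ^ (Nt - 1) * Nt * Real.exp (Nt / ρ) *
        ∑ k ∈ Finset.range Nr, MimoScheduling.mmseBeta Nt ρ k * ((Nt : ℝ) / ρ) ^ k *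
          ∑ q ∈ Finset.range (k + 1), (k.choose q : ℝ) * (-1) ^ (k - q) * (ρ / Nt) ^ q *
            MimoScheduling.upperIncompleteGamma (1 - (Nt : ℝ) + q) (Nt / ρ) := by
  have hN : (0 : ℝ) < Nt := by exact_mod_cast hNt
  have hc : 0 < ρ / Nt := by positivity
  have hcont := continuous_regularizedForm_curry (ι := Fin Nr) (κ := {j // j ≠ i}) hc.le
  have hlaw := hasLaw_col_prod_interference hH i
  have hcard : Fintype.card {j // j ≠ i} = Nt - 1 := by
    rw [Fintype.card_subtype_compl, Fintype.card_subtype_eq, Fintype.card_fin]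
  obtain ⟨hint, hval⟩ := integrable_and_integral_log_one_add hcont.measurable
    (fun p => regularizedForm_nonneg hc.le _ _) hc (n := Nr) (m := Nt - 1)
    (fun t ht => by
      rw [stdComplexGaussianVector_prod_lt_regularizedForm hc.le (le_of_lt ht), hcard,
        Fintype.card_fin])
  have hlogb : ∀ ω, Real.logb 2 (1 + ρ / Nt * normalizedMmseSINR ρ (Matrix.of (H ω)) i) =
      Real.log (1 + ρ / Nt * regularizedForm (ρ / Nt) (fun r => H ω r i)
        (Matrix.of (Function.curry fun p : Fin Nr × {j // j ≠ i} => H ω p.1 p.2))) /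
        Real.log 2 := by
    intro ω
    rw [normalizedMmseSINR_eq_regularizedForm hNt hρ]
    rfl
  have hint' := (hlaw.map_eq ▸ hint).comp_aemeasurable hlaw.aemeasurable
  have hval' := hlaw.integral_comp hint.aestronglyMeasurable
  rw [hval, (integrableOn_and_integral_mmseTail_div hc Nr (Nt - 1)).2] at hval'
  refine ⟨?_, ?_⟩
  · simp_rw [hlogb]
    exact hint'.div_const _
  · rw [roundRobinSumRate]
    simp_rw [hlogb]
    rw [integral_div]
    rw [Function.comp_def] at hval'
    rw [hval', Nat.sub_add_cancel hNt, inv_div]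
    simp_rw [mmseBeta_eq_mmseCoeff hNt hρ]
    rw [Real.logb, Real.log_exp]
    ring
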